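/- Let $n\ge 1$, $0\le m\le n$, $\Pi=[0,1]\times[0,\infty)$. Let $a_j,b_j:[0,1]\to\mathbb R$ ($1\le j\le n$) and $h=(h_1,\dots,h_n):\mathbb R^n\to\mathbb R^n$ be continuous, $h(0)=0$, and suppose that for some $a>0$ one has $a_j\ge a$ on $[0,1]$ for $j\le m$ and $a_j\le -a$ on $[0,1]$ for $j>m$. Consider the autonomous problem $$\partial_tu_j+a_j(x)\partial_xu_j+b_j(x)u_j=0\ (0<x<1,\ t>0,\ j\le n),\qquad u(x,0)=\varphi(x),\qquad u^{out}(t)=h(u^{in}(t))\ (t\ge 0),\tag{1}$$ where, for a function $f$ on $[0,1]$, $f^{out}=(f_1(0),\dots,f_m(0),f_{m+1}(1),\dots,f_n(1))$ and $f^{in}=(f_1(1),\dots,f_m(1),f_{m+1}(0),\dots,f_n(0))$, and $u^{out}(t),u^{in}(t)$ are these vectors for $f=u(\cdot,t)$. Let $C_h([0,1])^n$ (resp. $C^1_h([0,1])^n$) be the set of continuous (resp. $C^1$) functions $\varphi:[0,1]\to\mathbb R^n$ with $\varphi^{out}=h(\varphi^{in})$, and $C_h(\Pi)^n$ the set of continuous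 $u:\Pi\to\mathbb R^n$ with $u^{out}(0)=h(u^{in}(0))$. For $(x,t)\in\Pi$ let $\omega_j(\xi,x,t)=t+\int_x^\xi \frac{d\eta}{a_j(\eta)}$, $\xi\in[0,1]$, be the $j$-th characteristic through $(x,t)$ (the solution of $\partial_\xi\omega_j=1/a_j(\xi)$, $\omega_j(x,x,t)=t$), let $x_j(x,t)$ be the abscissa of the end with the smaller ordinate of the part of this curve that lies in $\Pi$, and let $c_j(\xi,x)=\exp\int_x^\xi \frac{b_j}{a_j}\,d\eta$. Let $x_j=0$ for $j\le m$ and $x_j=1$ for $j>m$. For $\varphi:[0,1]\to\mathbb R^n$ define $Q=Q_\varphi$ by $$[Q_\varphi u]_j(x,t)=\begin{cases}c_j(x_j,x)\,h_j\big(u^{in}(\omega_j(x_j,x,t))\big)&\text{if }x_j(x,t)=x_j,\\ c_j(x_j(x,t),x)\,\varphi_j(x_j(x,t))&\text{otherwise.}\end{cases}$$ A continuous solution of (1) is a $u\in C_h(\Pi)^n$ with $u(\cdot,0)=\varphi$ and $u=Q_\varphi u$ on $\Pi$. A piecewise continuously differentiable solution of (1) is a continuous $u:\Pi\to\mathbb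 R^n$ that is continuously differentiable on $\Pi$ off an at most countable union of characteristic curves, satisfies the differential equations off these curves, and satisfies the initial and boundary conditions. An $L^2$-generalized solution of (1) for $\varphi\in L^2(0,1)^n$ is a $u\in C([0,\infty),L^2(0,1)^n)$ such that, for every sequence $\varphi^l\in C_h^1([0,1])^n$ converging to $\varphi$ in $L^2(0,1)^n$ and piecewise continuously differentiable solutions $u^l$ of (1) with initial functions $\varphi^l$, one has $\|u^l(\cdot,t)-u(\cdot,t)\|_{L^2(0,1)^n}\to0$ as $l\to\infty$, uniformly in $t\in[0,T]$, for each $T>0$. Problem (1) is called finite time stabilizable (FTS) in the sense of continuous (resp. $L^2$-generalized) solutions if there is $T>0$ such that for every $\varphi\in C_h([0,1])^n$ (resp. $\varphi\in L^2(0,1)^n$) the continuous (resp. $L^2$-generalized) solution vanishes for all $t>T$. Consider the condition (C) there are $T>0$ and a positive integer $q$ such that, for all positive integers $k$, all $w\in C_h(\Pi)^n$ and all $x\in[0,1]$, $[Q^{kq}w](x,kT)=0$, where $Q=Q_\varphi$ with $\varphi=w(\cdot,0)$. Then: 1. If (1) has a continuous solution for every $\varphi\in C_h([0,1])^n$, then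 (1) is FTS in the sense of continuous solutions if and only if (C) holds. 2. If all $a_j$, $b_j$ and $h_j$ are continuously differentiable and (1) has an $L^2$-generalized solution for every $\varphi\in L^2(0,1)^n$, then (1) is FTS in the sense of $L^2$-generalized solutions if and only if (C) holds. -/

import Mathlib

open Set Filter Topology MeasureTheory

noncomputable section

namespace Hyperbolic

/-- Data of the autonomous decoupled problem for `n` unknowns `u_j(x,t)`, `0 ≤ x ≤ 1`, `t ≥ 0`:
`∂_t u_j + a_j(x) ∂_x u_j + b_j(x) u_j = 0` with boundary conditions `u^out(t) = h(u^in(t))`.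
The component `j : Fin n` belongs to the first group of components if `(j : ℕ) < m`
(speed positive), and to the second one otherwise (speed negative). -/
structure Problem (n : ℕ) where
  m : ℕ
  a : Fin n → ℝ → ℝ
  b : Fin n → ℝ → ℝ
  h : (Fin n → ℝ) → (Fin n → ℝ)

/-- The half-strip `0 ≤ x ≤ 1`, `t ≥ 0`; a point is written `(x, t)`. -/
def strip : Set (ℝ × ℝ) := {p | p.1 ∈ Icc (0 : ℝ) 1 ∧ 0 ≤ p.2}

/-- The space `L²(0,1)^n`, with norm `(∫ ∑ i, (u i)²)^(1/2)`. -/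
abbrev L2 (n : ℕ) : Type :=
  Lp (EuclideanSpace ℝ (Fin n)) 2 (volume.restrict (Ioo (0 : ℝ) 1))

/-- The `L²(0,1)^n`-distance between a function and an element of `L²(0,1)^n`. -/
def distL2 {n : ℕ} (f : ℝ → Fin n → ℝ) (g : L2 n) : ENNReal :=
  eLpNorm (fun x => WithLp.toLp 2 (f x) - g x) 2 (volume.restrict (Ioo (0 : ℝ) 1))

namespace Problem

variable {n : ℕ} (P : Problem n)

/-- The end of `[0,1]` from which the `j`-th component enters the domain. -/
def outEnd (j : Fin n) : ℝ := if (j : ℕ) < P.m then 0 else 1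

/-- The end of `[0,1]` at which the `j`-th component leaves the domain. -/
def inEnd (j : Fin n) : ℝ := if (j : ℕ) < P.m then 1 else 0

/-- `f^out = (f_1(0), …, f_m(0), f_{m+1}(1), …, f_n(1))`. -/
def out (f : ℝ → Fin n → ℝ) : Fin n → ℝ := fun j => f (P.outEnd j) j

/-- `f^in = (f_1(1), …, f_m(1), f_{m+1}(0), …, f_n(0))`. -/
def inn (f : ℝ → Fin n → ℝ) : Fin n → ℝ := fun j => f (P.inEnd j) j

/-- The set `C_h([0,1])^n`. -/
def InCh (φ : ℝ → Fin n → ℝ) : Prop :=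
  ContinuousOn φ (Icc 0 1) ∧ P.out φ = P.h (P.inn φ)

/-- The set `C_h^1([0,1])^n`. -/
def InC1h (φ : ℝ → Fin n → ℝ) : Prop :=
  ContDiffOn ℝ 1 φ (Icc 0 1) ∧ P.out φ = P.h (P.inn φ)

/-- The set `C_h(Π)^n`, where `Π` is the half-strip. -/
def InChStrip (u : ℝ × ℝ → Fin n → ℝ) : Prop :=
  ContinuousOn u strip ∧ P.out (fun x => u (x, 0)) = P.h (P.inn (fun x => u (x, 0)))

/-- The `j`-th characteristic through `(x, t)`, as a function of the abscissa `ξ ∈ [0,1]`.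
Since `a_j` does not depend on time, the initial value problem `∂_ξ ω = 1 / a_j(ξ)`, `ω(x) = t`
is solved by integration. -/
def ω (j : Fin n) (ξ x t : ℝ) : ℝ := t + ∫ η in x..ξ, 1 / P.a j η

/-- `c_j(ξ, x) = exp ∫_x^ξ (b_j / a_j)`. -/
def c (j : Fin n) (ξ x : ℝ) : ℝ := Real.exp (∫ η in x..ξ, P.b j η / P.a j η)

/-- The abscissa of that end of the part in the half-strip of the `j`-th characteristic through
`(x, t)` which has the smaller ordinate: the left end if `ω_j` increases (positive speed),
the right end if `ω_j` decreases (negative speed). -/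
def foot (j : Fin n) (x t : ℝ) : ℝ :=
  if (j : ℕ) < P.m then sInf {ξ | ξ ∈ Icc (0 : ℝ) 1 ∧ 0 ≤ P.ω j ξ x t}
  else sSup {ξ | ξ ∈ Icc (0 : ℝ) 1 ∧ 0 ≤ P.ω j ξ x t}

/-- The operator `S`, from functions of time to functions on the half-strip. -/
def S (v : ℝ → Fin n → ℝ) : ℝ × ℝ → Fin n → ℝ := fun p j =>
  P.c j (P.foot j p.1 p.2) p.1 * v (P.ω j (P.foot j p.1 p.2) p.1 p.2) j

/-- The boundary operator `R`. -/
def R (u : ℝ × ℝ → Fin n → ℝ) : ℝ → Fin n → ℝ := fun t =>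
  P.h (P.inn (fun x => u (x, t)))

/-- The operator `Q_φ`. The foot of a characteristic is either on the side of the half-strip from
which the `j`-th component enters, or on the initial axis (including, for `t = 0`, the corner
at which the `j`-th component leaves the domain). -/
def Q (φ : ℝ → Fin n → ℝ) (u : ℝ × ℝ → Fin n → ℝ) : ℝ × ℝ → Fin n → ℝ := fun p j =>
  if P.foot j p.1 p.2 = P.outEnd j then P.S (P.R u) p j
  else P.c j (P.foot j p.1 p.2) p.1 * φ (P.foot j p.1 p.2) j

/-- Membership in the domain `D(Q_φ)`. -/
def InDomQ (φ : ℝ → Fin n → ℝ) (u : ℝ × ℝ → Fin n → ℝ) : Prop :=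
  P.InChStrip u ∧ ∀ x ∈ Icc (0 : ℝ) 1, u (x, 0) = φ x

/-- `u` is a continuous solution with initial function `φ`. -/
def IsContSol (φ : ℝ → Fin n → ℝ) (u : ℝ × ℝ → Fin n → ℝ) : Prop :=
  P.InDomQ φ u ∧ ∀ p ∈ strip, u p = P.Q φ u p

/-- The `j`-th characteristic curve through the point `p`, as a subset of the plane. -/
def charCurve (j : Fin n) (p : ℝ × ℝ) : Set (ℝ × ℝ) :=
  {z | z.1 ∈ Icc (0 : ℝ) 1 ∧ z.2 = P.ω j z.1 p.1 p.2}

/-- `u` is a piecewise continuously differentiable solution with initial function `φ`: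
it is continuous on the half-strip, continuously differentiable there off the union `N` of at most
countably many characteristic curves, and satisfies the system off `N`, the initial condition and
the boundary conditions. -/
def IsPC1Sol (φ : ℝ → Fin n → ℝ) (u : ℝ × ℝ → Fin n → ℝ) : Prop :=
  ContinuousOn u strip ∧
  (∃ Γ : Set (Fin n × (ℝ × ℝ)), Γ.Countable ∧ (∀ γ ∈ Γ, γ.2 ∈ strip) ∧
    ∃ N : Set (ℝ × ℝ), N = (⋃ γ ∈ Γ, P.charCurve γ.1 γ.2) ∧
      (∀ p ∈ strip \ N, DifferentiableWithinAt ℝ u strip p) ∧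
      ContinuousOn (fun p => fderivWithin ℝ u strip p) (strip \ N) ∧
      ∀ p ∈ strip \ N, 0 < p.1 → p.1 < 1 → 0 < p.2 → ∀ j : Fin n,
        fderivWithin ℝ u strip p (0, 1) j
          + P.a j p.1 * fderivWithin ℝ u strip p (1, 0) j + P.b j p.1 * u p j = 0) ∧
  (∀ x ∈ Icc (0 : ℝ) 1, u (x, 0) = φ x) ∧
  (∀ t : ℝ, 0 ≤ t → P.out (fun x => u (x, t)) = P.h (P.inn (fun x => u (x, t))))

/-- `u ∈ C([0,∞), L²(0,1)^n)` is an `L²`-generalized solution with initial function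
`φ ∈ L²(0,1)^n`: for all `φ^l ∈ C_h^1([0,1])^n` converging to `φ` in `L²`, the piecewise
continuously differentiable solutions `u^l` with initial functions `φ^l` converge to `u` in `L²`,
uniformly in `t ∈ [0,T]` for each `T > 0`. -/
def IsL2Sol (φ : L2 n) (u : ℝ → L2 n) : Prop :=
  ContinuousOn u (Ici 0) ∧
  ∀ φs : ℕ → ℝ → Fin n → ℝ, (∀ l, P.InC1h (φs l)) →
    Tendsto (fun l => distL2 (φs l) φ) atTop (𝓝 0) →
    ∀ us : ℕ → ℝ × ℝ → Fin n → ℝ, (∀ l, P.IsPC1Sol (φs l) (us l)) →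
      ∀ T : ℝ, 0 < T → ∀ ε : ENNReal, 0 < ε →
        ∀ᶠ l in atTop, ∀ t ∈ Icc 0 T, distL2 (fun x => us l (x, t)) (u t) ≤ ε

/-- Finite time stabilizability in the sense of continuous solutions. -/
def IsFTSCont : Prop :=
  ∃ T : ℝ, 0 < T ∧ ∀ φ, P.InCh φ → ∀ u, P.IsContSol φ u →
    ∀ x ∈ Icc (0 : ℝ) 1, ∀ t : ℝ, T < t → u (x, t) = 0

/-- Finite time stabilizability in the sense of `L²`-generalized solutions. -/
def IsFTSL2 : Prop :=
  ∃ T : ℝ, 0 < T ∧ ∀ φ u, P.IsL2Sol φ u → ∀ t : ℝ, T < t → u t = 0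

/-- There are `T > 0` and a positive integer `q` such that `[Q^{kq} w](x, kT) = 0` for all
positive integers `k`, all `w ∈ C_h(Π)^n` and all `x ∈ [0,1]`, where `Q = Q_φ` with
`φ = w(·, 0)`. -/
def QPowersVanish : Prop :=
  ∃ T : ℝ, 0 < T ∧ ∃ q : ℕ, 0 < q ∧ ∀ k : ℕ, 0 < k → ∀ w, P.InChStrip w →
    ∀ x ∈ Icc (0 : ℝ) 1, ((P.Q (fun y => w (y, 0)))^[k * q] w) (x, k * T) = 0

/-- The characteristics solve the initial value problem that defines them. -/
theorem ω_spec (j : Fin n) (ha : ContinuousOn (P.a j) (Icc 0 1))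
    (h0 : ∀ x ∈ Icc (0 : ℝ) 1, P.a j x ≠ 0) {x ξ t : ℝ} (hx : x ∈ Icc (0 : ℝ) 1)
    (hξ : ξ ∈ Icc (0 : ℝ) 1) :
    P.ω j x x t = t ∧
      HasDerivWithinAt (fun η => P.ω j η x t) (1 / P.a j ξ) (Icc 0 1) ξ := by
  have hc : ContinuousOn (fun η => 1 / P.a j η) (Icc 0 1) := continuousOn_const.div ha h0
  refine ⟨by simp [ω], ?_⟩
  have hi : IntervalIntegrable (fun η => 1 / P.a j η) volume x ξ :=
    (hc.mono (uIcc_subset_Icc hx hξ)).intervalIntegrable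
  have : Fact (ξ ∈ Icc (0 : ℝ) 1) := ⟨hξ⟩
  have hd := intervalIntegral.integral_hasDerivWithinAt_right (s := Icc 0 1) (t := Icc 0 1) hi
    (hc.stronglyMeasurableAtFilter_nhdsWithin measurableSet_Icc ξ) (hc ξ hξ)
  exact hd.const_add t

end Problem

end Hyperbolic

end

noncomputable section

/-! The system is decoupled and autonomous, so for a fixed point `u` of `Q` the quotient of `u_j` by
`weight j` is constant along the `j`-th characteristics. It depends only on the entrance time `s = t
- travelTime j x`, which is negative when the characteristic starts on the initial axis. In this
variable (`Q_eq`) the equation `u = Q u` becomes a difference equation: `g` is `history φ` for `s <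
0`, and `g s` is `reflect` of the vector of the `g (s - crossTime i) i` for `s ≥ 0`. All delays are
at least some `δ > 0`.

Continuous solutions: each application of `Q` extends the set of entrance times with correct values
by `δ`. From any starting function the iterates thus agree with the fixed point on bounded time
intervals after a number of steps proportional to the time (`Q_iterate_eq`), and vanishing for `t >
T` gives the condition on powers. Conversely, a solution is unchanged by the iterates and its time
shifts are solutions (`isContSol_shift`), so the condition with `k = 1`, applied to the shift by `t
- T`, kills it at time `t`.

Generalized solutions: for compatible `C¹` data the difference equation yields one function that is
both a continuous and a piecewise `C¹` solution (`exists_solution`). Such data are dense in `L²`,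
since functions vanishing at both ends are compatible by `h 0 = 0`; hence decay passes from
continuous to generalized solutions. For the other direction, `w (·, 0)` is a pointwise limit of
compatible `C¹` functions, for which the iterates vanish, and the iterates depend continuously on
the initial function (`tendsto_Q_iterate`). -/

/-- A `C¹` function on the line whose derivative is bounded below by a positive constant has a
`C¹` inverse. -/
theorem exists_contDiff_inverse {f f' : ℝ → ℝ} {κ : ℝ} (hκ : 0 < κ)
    (hf : ∀ x, HasDerivAt f (f' x) x) (hf' : Continuous f') (hle : ∀ x, κ ≤ f' x) :
    ∃ σ : ℝ → ℝ, ContDiff ℝ 1 σ ∧ Function.LeftInverse σ f ∧ Function.RightInverse σ f := by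
  have hd : deriv f = f' := funext fun x => (hf x).deriv
  have hdiff : Differentiable ℝ f := fun x => (hf x).differentiableAt
  have hC : ContDiff ℝ 1 f := contDiff_one_iff_deriv.2 ⟨hdiff, hd ▸ hf'⟩
  have hmono : StrictMono f :=
    strictMono_of_deriv_pos fun x => by rw [hd]; exact hκ.trans_le (hle x)
  -- Comparison with a line of slope `κ` gives both limits at infinity, hence surjectivity.
  have hlin : Monotone fun x => f x - κ * x := by
    have h : ∀ x, HasDerivAt (fun x => f x - κ * x) (f' x - κ) x := fun x => by
      have := (hf x).sub ((hasDerivAt_id x).const_mul κ)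
      rw [mul_one] at this
      exact this
    refine monotone_of_deriv_nonneg (fun x => (h x).differentiableAt) fun x => ?_
    rw [(h x).deriv]
    exact sub_nonneg.2 (hle x)
  have htop : Tendsto f atTop atTop := by
    refine tendsto_atTop_mono' atTop (f₁ := fun x => f 0 + κ * x) ?_
      (tendsto_atTop_add_const_left _ _ (tendsto_id.const_mul_atTop hκ))
    filter_upwards [eventually_ge_atTop 0] with x hx
    have := hlin hx
    simp only [mul_zero, sub_zero] at this
    linarith
  have hbot : Tendsto f atBot atBot := by
    refine tendsto_atBot_mono' atBot (f₁ := fun x => f 0 + κ * x) ?_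
      (tendsto_atBot_add_const_left _ _ (tendsto_id.const_mul_atBot hκ))
    filter_upwards [eventually_le_atBot 0] with x hx
    have := hlin hx
    simp only [mul_zero, sub_zero] at this
    linarith
  let e := hmono.orderIsoOfSurjective f (hdiff.continuous.surjective htop hbot)
  refine ⟨e.toHomeomorph.symm, e.toHomeomorph.contDiff_symm_deriv
    (fun x => (hκ.trans_le (hle x)).ne') hf hC, e.left_inv, e.right_inv⟩

/-! ### Characteristics: travel times, weights and positions -/

namespace Hyperbolic.Problem

variable {n : ℕ}

/-- The standing assumptions on the data. -/
structure Admissible (P : Problem n) : Prop where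
  continuousOn_a : ∀ j, ContinuousOn (P.a j) (Icc 0 1)
  continuousOn_b : ∀ j, ContinuousOn (P.b j) (Icc 0 1)
  continuous_h : Continuous P.h
  exists_le : ∃ a₀ : ℝ, 0 < a₀ ∧ ∀ j : Fin n, ∀ x ∈ Icc (0 : ℝ) 1,
      ((j : ℕ) < P.m → a₀ ≤ P.a j x) ∧ (P.m ≤ (j : ℕ) → P.a j x ≤ -a₀)
  h_zero : P.h 0 = 0

variable (P : Problem n)

/-- The speed `a_j`, extended to the line by its boundary values. -/
def speed (j : Fin n) : ℝ → ℝ := fun x => P.a j (projIcc 0 1 zero_le_one x)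

/-- The coefficient `b_j`, extended to the line by its boundary values. -/
def damping (j : Fin n) : ℝ → ℝ := fun x => P.b j (projIcc 0 1 zero_le_one x)

/-- The time that the `j`-th component needs to travel from its entrance to `x`. -/
def travelTime (j : Fin n) (x : ℝ) : ℝ := ∫ y in P.outEnd j..x, 1 / P.speed j y

/-- The factor by which the `j`-th component is multiplied between its entrance and `x`. -/
def weight (j : Fin n) (x : ℝ) : ℝ :=
  Real.exp (∫ y in x..P.outEnd j, P.damping j y / P.speed j y)

/-- The inverse of the travel time. -/
def position (j : Fin n) : ℝ → ℝ := Function.invFun (P.travelTime j)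

/-- The time that the `j`-th component needs to cross the domain. -/
def crossTime (j : Fin n) : ℝ := P.travelTime j (P.inEnd j)

/-- The initial data, as a function of the time of entrance of the characteristic. -/
def history (φ : ℝ → Fin n → ℝ) (s : ℝ) : Fin n → ℝ := fun j =>
  φ (P.position j (-s)) j / P.weight j (P.position j (-s))

/-- The boundary operator in terms of the values normalised by `weight`. -/
def reflect (v : Fin n → ℝ) : Fin n → ℝ := P.h fun i => P.weight i (P.inEnd i) * v i

theorem outEnd_mem (j : Fin n) : P.outEnd j ∈ Icc (0 : ℝ) 1 := by
  unfold outEnd; split_ifs <;> simp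

theorem inEnd_mem (j : Fin n) : P.inEnd j ∈ Icc (0 : ℝ) 1 := by
  unfold inEnd; split_ifs <;> simp

theorem weight_pos (j : Fin n) (x : ℝ) : 0 < P.weight j x := Real.exp_pos _

theorem speed_of_mem (j : Fin n) {x : ℝ} (hx : x ∈ Icc (0 : ℝ) 1) : P.speed j x = P.a j x := by
  rw [speed, projIcc_of_mem zero_le_one hx]

theorem damping_of_mem (j : Fin n) {x : ℝ} (hx : x ∈ Icc (0 : ℝ) 1) :
    P.damping j x = P.b j x := by
  rw [damping, projIcc_of_mem zero_le_one hx]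

@[simp] theorem travelTime_outEnd (j : Fin n) : P.travelTime j (P.outEnd j) = 0 := by
  simp [travelTime]

@[simp] theorem weight_outEnd (j : Fin n) : P.weight j (P.outEnd j) = 1 := by
  simp [weight]

variable {P}

namespace Admissible

variable (hP : P.Admissible)
include hP

theorem continuous_speed (j : Fin n) : Continuous (P.speed j) :=
  (hP.continuousOn_a j).comp_continuous (continuous_subtype_val.comp continuous_projIcc)
    fun x => (projIcc 0 1 zero_le_one x).2

theorem continuous_damping (j : Fin n) : Continuous (P.damping j) :=
  (hP.continuousOn_b j).comp_continuous (continuous_subtype_val.comp continuous_projIcc)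
    fun x => (projIcc 0 1 zero_le_one x).2

theorem speed_pos {j : Fin n} (hj : (j : ℕ) < P.m) (x : ℝ) : 0 < P.speed j x := by
  obtain ⟨a₀, h0, h⟩ := hP.exists_le
  exact h0.trans_le ((h j _ (projIcc 0 1 zero_le_one x).2).1 hj)

theorem speed_neg {j : Fin n} (hj : ¬ (j : ℕ) < P.m) (x : ℝ) : P.speed j x < 0 := by
  obtain ⟨a₀, h0, h⟩ := hP.exists_le
  exact ((h j _ (projIcc 0 1 zero_le_one x).2).2 (not_lt.1 hj)).trans_lt (neg_neg_of_pos h0)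

theorem speed_ne (j : Fin n) (x : ℝ) : P.speed j x ≠ 0 := by
  by_cases hj : (j : ℕ) < P.m
  exacts [(hP.speed_pos hj x).ne', (hP.speed_neg hj x).ne]

theorem continuous_inv_speed (j : Fin n) : Continuous fun x => 1 / P.speed j x :=
  continuous_const.div (hP.continuous_speed j) (hP.speed_ne j)

theorem continuous_rate (j : Fin n) : Continuous fun x => P.damping j x / P.speed j x :=
  (hP.continuous_damping j).div (hP.continuous_speed j) (hP.speed_ne j)

theorem hasDerivAt_travelTime (j : Fin n) (x : ℝ) :
    HasDerivAt (P.travelTime j) (1 / P.speed j x) x :=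
  intervalIntegral.integral_hasDerivAt_right
    ((hP.continuous_inv_speed j).intervalIntegrable _ _)
    ((hP.continuous_inv_speed j).stronglyMeasurableAtFilter _ _)
    (hP.continuous_inv_speed j).continuousAt

theorem hasDerivAt_weight (j : Fin n) (x : ℝ) :
    HasDerivAt (P.weight j) (-(P.damping j x / P.speed j x) * P.weight j x) x := by
  have := (intervalIntegral.integral_hasDerivAt_left
    ((hP.continuous_rate j).intervalIntegrable x (P.outEnd j))
    ((hP.continuous_rate j).stronglyMeasurableAtFilter _ _)
    (hP.continuous_rate j).continuousAt).exp
  convert! this using 1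
  exact mul_comm _ _

theorem contDiff_travelTime (j : Fin n) : ContDiff ℝ 1 (P.travelTime j) := by
  refine contDiff_one_iff_deriv.2 ⟨fun x => (hP.hasDerivAt_travelTime j x).differentiableAt, ?_⟩
  rw [funext fun x => (hP.hasDerivAt_travelTime j x).deriv]
  exact hP.continuous_inv_speed j

theorem differentiable_weight (j : Fin n) : Differentiable ℝ (P.weight j) :=
  fun x => (hP.hasDerivAt_weight j x).differentiableAt

theorem contDiff_weight (j : Fin n) : ContDiff ℝ 1 (P.weight j) := by
  refine contDiff_one_iff_deriv.2 ⟨hP.differentiable_weight j, ?_⟩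
  rw [funext fun x => (hP.hasDerivAt_weight j x).deriv]
  exact (hP.continuous_rate j).neg.mul (hP.differentiable_weight j).continuous

theorem exists_speed_le (j : Fin n) : ∃ M : ℝ, 0 < M ∧ ∀ x, |P.speed j x| ≤ M := by
  obtain ⟨M, hM⟩ := isCompact_Icc.exists_bound_of_continuousOn (hP.continuousOn_a j)
  exact ⟨max M 1, by positivity, fun x =>
    (hM _ (projIcc 0 1 zero_le_one x).2).trans (le_max_left _ _)⟩

/-- With the speed extended by constants, `1 / speed` keeps its sign and stays away from zero, so
the travel time is a `C¹` diffeomorphism of the whole line. This makes `history` globally `C¹` for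
`C¹` data. For negative speed the argument runs with `-travelTime`. -/
theorem exists_inverse (j : Fin n) : ∃ σ : ℝ → ℝ, ContDiff ℝ 1 σ ∧
    Function.LeftInverse σ (P.travelTime j) ∧ Function.RightInverse σ (P.travelTime j) := by
  obtain ⟨M, hM, hle⟩ := hP.exists_speed_le j
  by_cases hj : (j : ℕ) < P.m
  · refine exists_contDiff_inverse (one_div_pos.2 hM) (hP.hasDerivAt_travelTime j)
      (hP.continuous_inv_speed j) fun x => ?_
    exact one_div_le_one_div_of_le (hP.speed_pos hj x) ((le_abs_self _).trans (hle x))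
  · obtain ⟨σ, h1, h2, h3⟩ := exists_contDiff_inverse (f := fun x => -P.travelTime j x)
      (f' := fun x => -(1 / P.speed j x)) (one_div_pos.2 hM)
      (fun x => (hP.hasDerivAt_travelTime j x).neg)
      (hP.continuous_inv_speed j).neg fun x => by
        rw [← one_div_neg_eq_neg_one_div]
        exact one_div_le_one_div_of_le (neg_pos.2 (hP.speed_neg hj x))
          ((neg_le_abs _).trans (hle x))
    refine ⟨fun s => σ (-s), h1.comp contDiff_neg, h2, fun s => ?_⟩
    have := h3 (-s)
    simp only at this
    linarith

theorem position_travelTime (j : Fin n) (x : ℝ) : P.position j (P.travelTime j x) = x := by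
  obtain ⟨σ, -, h, -⟩ := hP.exists_inverse j
  exact Function.leftInverse_invFun h.injective x

theorem travelTime_position (j : Fin n) (s : ℝ) : P.travelTime j (P.position j s) = s := by
  obtain ⟨σ, -, -, h⟩ := hP.exists_inverse j
  exact Function.rightInverse_invFun h.surjective s

theorem contDiff_position (j : Fin n) : ContDiff ℝ 1 (P.position j) := by
  obtain ⟨σ, h1, -, h⟩ := hP.exists_inverse j
  convert h1 using 1
  ext s
  rw [← h s, hP.position_travelTime, h s]

theorem strictMono_travelTime {j : Fin n} (hj : (j : ℕ) < P.m) :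
    StrictMono (P.travelTime j) := strictMono_of_deriv_pos fun x => by
  rw [(hP.hasDerivAt_travelTime j x).deriv]
  exact one_div_pos.2 (hP.speed_pos hj x)

theorem strictAnti_travelTime {j : Fin n} (hj : ¬ (j : ℕ) < P.m) :
    StrictAnti (P.travelTime j) := strictAnti_of_deriv_neg fun x => by
  rw [(hP.hasDerivAt_travelTime j x).deriv]
  exact one_div_neg.2 (hP.speed_neg hj x)

theorem travelTime_nonneg (j : Fin n) {x : ℝ} (hx : x ∈ Icc (0 : ℝ) 1) :
    0 ≤ P.travelTime j x := by
  rw [← P.travelTime_outEnd j]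
  by_cases hj : (j : ℕ) < P.m
  · exact (hP.strictMono_travelTime hj).monotone (by simpa [outEnd, hj] using hx.1)
  · exact (hP.strictAnti_travelTime hj).antitone (by simpa [outEnd, hj] using hx.2)

theorem travelTime_injective (j : Fin n) : Function.Injective (P.travelTime j) :=
  Function.LeftInverse.injective (hP.position_travelTime j)

theorem crossTime_pos (j : Fin n) : 0 < P.crossTime j := by
  refine (hP.travelTime_nonneg j (P.inEnd_mem j)).lt_of_ne fun h => ?_
  rw [← P.travelTime_outEnd j] at h
  have := hP.travelTime_injective j h
  unfold inEnd outEnd at this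
  split_ifs at this <;> norm_num at this

/-- The uniform delay that drives all inductions in time; for `n = 0` any positive number serves. -/
theorem exists_le_crossTime : ∃ δ : ℝ, 0 < δ ∧ ∀ j, δ ≤ P.crossTime j := by
  rcases isEmpty_or_nonempty (Fin n) with h | h
  · exact ⟨1, one_pos, fun j => h.elim j⟩
  · obtain ⟨i, hi⟩ := Finite.exists_min P.crossTime
    exact ⟨_, hP.crossTime_pos i, hi⟩

theorem ω_eq (j : Fin n) {x ξ : ℝ} (t : ℝ) (hx : x ∈ Icc (0 : ℝ) 1) (hξ : ξ ∈ Icc (0 : ℝ) 1) :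
    P.ω j ξ x t = t + P.travelTime j ξ - P.travelTime j x := by
  have h : ∀ y z, IntervalIntegrable (fun x => 1 / P.speed j x) volume y z :=
    (hP.continuous_inv_speed j).intervalIntegrable
  rw [ω, travelTime, travelTime, add_sub_assoc, intervalIntegral.integral_interval_sub_left
    (h _ _) (h _ _)]
  congr 1
  refine intervalIntegral.integral_congr fun y hy => ?_
  simp only [P.speed_of_mem j (uIcc_subset_Icc hx hξ hy)]

theorem c_eq (j : Fin n) {x ξ : ℝ} (hx : x ∈ Icc (0 : ℝ) 1) (hξ : ξ ∈ Icc (0 : ℝ) 1) :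
    P.c j ξ x = P.weight j x / P.weight j ξ := by
  have h : ∀ y z, IntervalIntegrable (fun x => P.damping j x / P.speed j x) volume y z :=
    (hP.continuous_rate j).intervalIntegrable
  rw [c, weight, weight, ← Real.exp_sub,
    ← intervalIntegral.integral_add_adjacent_intervals (h x ξ) (h ξ _), add_sub_cancel_right]
  congr 1
  refine intervalIntegral.integral_congr fun y hy => ?_
  simp only [P.speed_of_mem j (uIcc_subset_Icc hx hξ hy),
    P.damping_of_mem j (uIcc_subset_Icc hx hξ hy)]

end Admissible

end Hyperbolic.Problem

/-! ### Difference equations with positive delays: existence -/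

/-- Induction in steps of length `δ` along the line. -/
theorem delay_induction {δ : ℝ} (hδ : 0 < δ) {p : ℝ → Prop} (h0 : ∀ s < 0, p s)
    (h1 : ∀ s, 0 ≤ s → (∀ r ≤ s - δ, p r) → p s) (s : ℝ) : p s := by
  have key : ∀ k : ℕ, ∀ s < k * δ, p s := by
    intro k
    induction k with
    | zero => intro s hs; exact h0 s (by simpa using hs)
    | succ k ih =>
      intro s hs
      rcases lt_or_ge s 0 with h | h
      · exact h0 s h
      · refine h1 s h fun r hr => ih r ?_
        push_cast at hs
        linarith
  obtain ⟨k, hk⟩ := exists_nat_gt (s / δ)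
  exact key k s ((div_lt_iff₀ hδ).1 hk)

/-- Solvability of a system of difference equations with positive delays. -/
theorem exists_delay_solution {ι : Type*} {E : ι → Type*} {δ : ℝ} (hδ : 0 < δ) {τ : ι → ℝ}
    (hτ : ∀ i, δ ≤ τ i) (ψ : ℝ → ∀ i, E i) (H : (∀ i, E i) → ∀ i, E i) :
    ∃ g : ℝ → ∀ i, E i, (∀ s < 0, g s = ψ s) ∧
      ∀ s, 0 ≤ s → g s = H fun i => g (s - τ i) i := by
  -- Picard iterates: since the delays are at least `δ`, the `k`-th one is already final for `s < k
  -- * δ`.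
  let G : ℕ → ℝ → ∀ i, E i := fun k => Nat.rec ψ
    (fun _ u s => if s < 0 then ψ s else H fun i => u (s - τ i) i) k
  have hG : ∀ k s, G (k + 1) s = if s < 0 then ψ s else H fun i => G k (s - τ i) i :=
    fun _ _ => rfl
  have hneg : ∀ k, ∀ s < 0, G k s = ψ s := by
    intro k s hs
    cases k with
    | zero => rfl
    | succ k => rw [hG, if_pos hs]
  have hstab : ∀ k : ℕ, ∀ s < k * δ, ∀ l, k ≤ l → G l s = G k s := by
    intro k
    induction k with
    | zero =>
      intro s hs l _
      rw [hneg l s (by simpa using hs), hneg 0 s (by simpa using hs)]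
    | succ k ih =>
      intro s hs l hl
      obtain ⟨l, rfl⟩ := Nat.exists_eq_add_of_le' hl
      rw [← add_assoc, hG, hG]
      congr 2
      ext i
      rw [ih (s - τ i) (by push_cast at hs; linarith [hτ i]) (l + k) (by omega)]
  have hlt : ∀ s : ℝ, s < (⌊s / δ⌋₊ + 1 : ℕ) * δ := fun s =>
    (div_lt_iff₀ hδ).1 (by exact_mod_cast Nat.lt_floor_add_one (s / δ))
  -- The index `⌊s / δ⌋₊ + 1` is large enough for `G` to be final at `s`.
  refine ⟨fun s => G (⌊s / δ⌋₊ + 1) s, fun s hs => hneg (⌊s / δ⌋₊ + 1) s hs, fun s hs => ?_⟩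
  simp only
  rw [hG, if_neg hs.not_gt]
  congr 1
  ext i
  have hle : s - τ i ≤ s - δ := by linarith [hτ i]
  have hk : s - τ i < (⌊s / δ⌋₊ : ℕ) * δ := by
    have := hlt s
    push_cast at this
    linarith
  have h1 := hstab _ _ hk (⌊s / δ⌋₊ + 1) (by omega)
  have h2 := hstab _ _ (hlt (s - τ i)) (⌊s / δ⌋₊ + 1) (by gcongr; linarith)
  rw [← h1, h2]

/-! ### The operator `Q` in terms of entrance times, its iterates, and continuous solutions -/

namespace Hyperbolic.Problem

variable {n : ℕ} {P : Problem n}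

theorem R_congr {u v : ℝ × ℝ → Fin n → ℝ} {s t : ℝ}
    (h : ∀ i, u (P.inEnd i, s) i = v (P.inEnd i, t) i) : P.R u s = P.R v t :=
  congrArg P.h (funext h)

namespace Admissible

variable (hP : P.Admissible)
include hP

theorem position_mem (j : Fin n) {x s : ℝ} (hx : x ∈ Icc (0 : ℝ) 1) (h0 : 0 ≤ s)
    (hs : s ≤ P.travelTime j x) : P.position j s ∈ Icc (0 : ℝ) 1 := by
  have h1 : P.travelTime j (P.position j s) ≤ P.travelTime j x := by
    rwa [hP.travelTime_position]
  have h2 : P.travelTime j (P.outEnd j) ≤ P.travelTime j (P.position j s) := by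
    rwa [hP.travelTime_position, travelTime_outEnd]
  by_cases hj : (j : ℕ) < P.m
  · have := (hP.strictMono_travelTime hj).le_iff_le.1 h1
    have := (hP.strictMono_travelTime hj).le_iff_le.1 h2
    simp only [outEnd, hj, if_true] at this
    exact ⟨by linarith, by linarith [hx.2]⟩
  · have := (hP.strictAnti_travelTime hj).le_iff_ge.1 h1
    have := (hP.strictAnti_travelTime hj).le_iff_ge.1 h2
    simp only [outEnd, hj, if_false] at this
    exact ⟨by linarith [hx.1], by linarith⟩

/-- The travel time increases away from the entrance for either sign of the speed, so minimising it
handles the infimum and the supremum in `foot` together. -/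
theorem foot_eq_of_least (j : Fin n) {x t y : ℝ} (hx : x ∈ Icc (0 : ℝ) 1)
    (hy : y ∈ Icc (0 : ℝ) 1) (h0 : P.travelTime j x - t ≤ P.travelTime j y)
    (hle : ∀ ξ ∈ Icc (0 : ℝ) 1, P.travelTime j x - t ≤ P.travelTime j ξ →
      P.travelTime j y ≤ P.travelTime j ξ) : P.foot j x t = y := by
  have hset : {ξ | ξ ∈ Icc (0 : ℝ) 1 ∧ 0 ≤ P.ω j ξ x t} =
      {ξ | ξ ∈ Icc (0 : ℝ) 1 ∧ P.travelTime j x - t ≤ P.travelTime j ξ} := by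
    ext ξ
    refine and_congr_right fun hξ => ?_
    rw [hP.ω_eq j t hx hξ]
    constructor <;> intro h <;> linarith
  rw [foot, hset]
  split_ifs with hj
  · exact IsLeast.csInf_eq ⟨⟨hy, h0⟩, fun ξ hξ =>
      (hP.strictMono_travelTime hj).le_iff_le.1 (hle ξ hξ.1 hξ.2)⟩
  · exact IsGreatest.csSup_eq ⟨⟨hy, h0⟩, fun ξ hξ =>
      (hP.strictAnti_travelTime hj).le_iff_ge.1 (hle ξ hξ.1 hξ.2)⟩

theorem foot_of_le (j : Fin n) {x t : ℝ} (hx : x ∈ Icc (0 : ℝ) 1) (h : P.travelTime j x ≤ t) :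
    P.foot j x t = P.outEnd j :=
  hP.foot_eq_of_least j hx (P.outEnd_mem j) (by rw [travelTime_outEnd]; linarith)
    fun ξ hξ _ => by rw [travelTime_outEnd]; exact hP.travelTime_nonneg j hξ

theorem foot_of_lt (j : Fin n) {x t : ℝ} (hx : x ∈ Icc (0 : ℝ) 1) (ht : 0 ≤ t)
    (h : t < P.travelTime j x) : P.foot j x t = P.position j (P.travelTime j x - t) := by
  refine hP.foot_eq_of_least j hx (hP.position_mem j hx (by linarith) (by linarith)) ?_ ?_
  · rw [hP.travelTime_position]
  · intro ξ _ hξ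
    rwa [hP.travelTime_position]

/-- `Q` in terms of the time `t - travelTime j x` of entrance of the characteristic. -/
theorem Q_eq (φ : ℝ → Fin n → ℝ) (u : ℝ × ℝ → Fin n → ℝ) (j : Fin n) {x t : ℝ}
    (hx : x ∈ Icc (0 : ℝ) 1) (ht : 0 ≤ t) :
    P.Q φ u (x, t) j = P.weight j x *
      if t - P.travelTime j x < 0 then P.history φ (t - P.travelTime j x) j
      else P.R u (t - P.travelTime j x) j := by
  rw [Q]
  split_ifs with h1 h2 h2
  -- A foot at the entrance would have travel time zero, while a negative entrance time makes it
  -- `travelTime j x - t > 0`.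
  · exfalso
    have h := hP.foot_of_lt j hx ht (by linarith)
    simp only at h1
    rw [h1] at h
    have := hP.travelTime_position j (P.travelTime j x - t)
    rw [← h, travelTime_outEnd] at this
    linarith
  · have h := hP.foot_of_le j hx (t := t) (by linarith)
    simp only [S]
    rw [h, hP.c_eq j hx (P.outEnd_mem j), hP.ω_eq j t hx (P.outEnd_mem j), weight_outEnd,
      travelTime_outEnd, div_one, add_zero]
  · have h := hP.foot_of_lt j hx ht (by linarith)
    have hm := hP.position_mem j hx (s := P.travelTime j x - t) (by linarith) (by linarith)
    simp only [history, neg_sub]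
    rw [h, hP.c_eq j hx hm]
    ring
  · exact (h1 (hP.foot_of_le j hx (by simp only; linarith))).elim

/-- Along characteristics, `u_j / weight_j` is constant for a fixed point `u` of `Q`. -/
theorem div_weight_congr {φ : ℝ → Fin n → ℝ} {u : ℝ × ℝ → Fin n → ℝ}
    (hu : ∀ p ∈ strip, u p = P.Q φ u p) (j : Fin n) {x x' t t' : ℝ} (hx : x ∈ Icc (0 : ℝ) 1)
    (hx' : x' ∈ Icc (0 : ℝ) 1) (ht : 0 ≤ t) (ht' : 0 ≤ t')
    (h : t - P.travelTime j x = t' - P.travelTime j x') :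
    u (x, t) j / P.weight j x = u (x', t') j / P.weight j x' := by
  rw [hu _ ⟨hx, ht⟩, hu _ ⟨hx', ht'⟩, hP.Q_eq φ u j hx ht, hP.Q_eq φ u j hx' ht', h,
    mul_div_cancel_left₀ _ (P.weight_pos j x).ne', mul_div_cancel_left₀ _ (P.weight_pos j x').ne']

/-- The problem is autonomous. -/
theorem isContSol_shift {φ : ℝ → Fin n → ℝ} {u : ℝ × ℝ → Fin n → ℝ} (hu : P.IsContSol φ u)
    {r : ℝ} (hr : 0 ≤ r) :
    P.IsContSol (fun x => u (x, r)) fun p => u (p.1, p.2 + r) := by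
  have hQ := hu.2
  refine ⟨⟨⟨hu.1.1.1.comp (by fun_prop) fun p hp => ⟨hp.1, add_nonneg hp.2 hr⟩, ?_⟩,
    fun x _ => by simp⟩, ?_⟩
  · ext j
    simp only [zero_add, out]
    rw [hQ _ ⟨P.outEnd_mem j, hr⟩, hP.Q_eq _ _ _ (P.outEnd_mem j) hr]
    simp [hr.not_gt, R]
  · rintro ⟨x, t⟩ ⟨hx, ht⟩
    ext j
    simp only at hx ht ⊢
    rw [hP.Q_eq _ _ _ hx ht, mul_comm, ← div_eq_iff (P.weight_pos j x).ne']
    split_ifs with h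
    · have hm := hP.position_mem j hx (s := P.travelTime j x - t) (by linarith) (by linarith)
      simp only [history, neg_sub]
      refine hP.div_weight_congr hQ j hx hm (add_nonneg ht hr) hr ?_
      rw [hP.travelTime_position]
      ring
    · rw [hQ _ ⟨hx, add_nonneg ht hr⟩, hP.Q_eq _ _ _ hx (add_nonneg ht hr),
        if_neg (by linarith), mul_div_cancel_left₀ _ (P.weight_pos j x).ne']
      refine congrFun (R_congr fun i => ?_) j
      simp only
      congr 2
      ring

/-- `Q ψ` reads `ψ` only on `[0,1]`, so agreement there is enough for a solution to remain fixed. -/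
theorem Q_iterate_eq_of_isContSol {φ ψ : ℝ → Fin n → ℝ} {u : ℝ × ℝ → Fin n → ℝ}
    (hu : P.IsContSol φ u) (hψ : ∀ x ∈ Icc (0 : ℝ) 1, ψ x = φ x) (k : ℕ) :
    ∀ p ∈ strip, (P.Q ψ)^[k] u p = u p := by
  induction k with
  | zero => intro p _; rfl
  | succ k ih =>
    rintro ⟨x, t⟩ ⟨hx, ht⟩
    ext j
    simp only at hx ht
    rw [Function.iterate_succ_apply', hu.2 _ ⟨hx, ht⟩, hP.Q_eq _ _ _ hx ht, hP.Q_eq _ _ _ hx ht]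
    congr 1
    split_ifs with h
    · have hm := hP.position_mem j hx (s := P.travelTime j x - t) (by linarith) (by linarith)
      simp only [history, neg_sub, hψ _ hm]
    · exact congrFun (R_congr fun i => by
        rw [ih _ ⟨P.inEnd_mem i, by simp only; linarith⟩]) j

/-- The iterates of `Q` become stationary on bounded time intervals. -/
theorem Q_iterate_eq {φ : ℝ → Fin n → ℝ} {u : ℝ × ℝ → Fin n → ℝ}
    (hu : ∀ p ∈ strip, u p = P.Q φ u p) (w : ℝ × ℝ → Fin n → ℝ) {δ : ℝ}
    (hδ : ∀ j, δ ≤ P.crossTime j) (k : ℕ) (j : Fin n) {x t : ℝ} (hx : x ∈ Icc (0 : ℝ) 1)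
    (ht : 0 ≤ t) (hlt : t - P.travelTime j x < k * δ) :
    (P.Q φ)^[k + 1] w (x, t) j = u (x, t) j := by
  induction k generalizing j x t with
  | zero =>
    -- For a negative entrance time `Q` reads only the initial function, so one application is
    -- already exact.
    rw [hu _ ⟨hx, ht⟩, Function.iterate_succ_apply', hP.Q_eq _ _ _ hx ht, hP.Q_eq _ _ _ hx ht,
      if_pos (by simpa using hlt), if_pos (by simpa using hlt)]
  | succ k ih =>
    rw [hu _ ⟨hx, ht⟩, Function.iterate_succ_apply', hP.Q_eq _ _ _ hx ht, hP.Q_eq _ _ _ hx ht]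
    congr 1
    split_ifs with h
    · rfl
    · refine congrFun (R_congr fun i => ih i (P.inEnd_mem i) (by linarith) ?_) j
      have := hδ i
      rw [crossTime] at this
      push_cast at hlt
      linarith

/-- The iterates of `Q` depend continuously on the initial function. -/
theorem tendsto_Q_iterate {φs : ℕ → ℝ → Fin n → ℝ} {φ : ℝ → Fin n → ℝ}
    (hφ : ∀ x ∈ Icc (0 : ℝ) 1, Tendsto (fun l => φs l x) atTop (𝓝 (φ x)))
    (w : ℝ × ℝ → Fin n → ℝ) (k : ℕ) :
    ∀ p ∈ strip, Tendsto (fun l => (P.Q (φs l))^[k] w p) atTop (𝓝 ((P.Q φ)^[k] w p)) := by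
  induction k with
  | zero => intro p _; exact tendsto_const_nhds
  | succ k ih =>
    rintro ⟨x, t⟩ ⟨hx, ht⟩
    simp only at hx ht
    rw [tendsto_pi_nhds]
    intro j
    simp only [Function.iterate_succ_apply', hP.Q_eq _ _ _ hx ht]
    refine Tendsto.const_mul _ ?_
    split_ifs with h
    · have hm := hP.position_mem j hx (s := P.travelTime j x - t) (by linarith) (by linarith)
      simp only [history, neg_sub]
      exact (tendsto_pi_nhds.1 (hφ _ hm) j).div_const _
    · refine tendsto_pi_nhds.1 (hP.continuous_h.continuousAt.tendsto.comp ?_) j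
      exact tendsto_pi_nhds.2 fun i => tendsto_pi_nhds.1
        (ih _ ⟨P.inEnd_mem i, by simp only; linarith⟩) i

/-- If the fixed points of the operators `Q φ` vanish for large times, then so do the iterates
of `Q`. -/
theorem exists_Q_iterate_eq_zero {T : ℝ} (hT : 0 < T) : ∃ q : ℕ, 0 < q ∧
    ∀ φ u, (∀ p ∈ strip, u p = P.Q φ u p) →
      (∀ x ∈ Icc (0 : ℝ) 1, ∀ t : ℝ, T < t → u (x, t) = 0) →
      ∀ k : ℕ, 0 < k → ∀ w, ∀ x ∈ Icc (0 : ℝ) 1, (P.Q φ)^[k * q] w (x, k * (T + 1)) = 0 := by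
  obtain ⟨δ, h0, hδ⟩ := hP.exists_le_crossTime
  obtain ⟨q, hq⟩ := exists_nat_gt ((T + 1) / δ)
  rw [div_lt_iff₀ h0] at hq
  refine ⟨q + 1, q.succ_pos, fun φ u hu hz k hk w x hx => ?_⟩
  have hk1 : (1 : ℝ) ≤ k := by exact_mod_cast hk
  -- Vanishing is known only for times strictly beyond `T`, whence `T + 1`.
  have hkT : T < k * (T + 1) := by nlinarith
  -- `Q_iterate_eq` loses one application. The exponent `k * (q + 1)` still leaves `l ≥ k * q`, and
  -- `q * δ > T + 1` gives `k * (T + 1) < l * δ`.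
  obtain ⟨l, hl⟩ : ∃ l, k * (q + 1) = l + 1 := Nat.exists_eq_succ_of_ne_zero (by positivity)
  have hle : k * q ≤ l := by
    have : k * (q + 1) = k * q + k := by ring
    omega
  rw [← hz x hx _ hkT, hl]
  ext j
  refine hP.Q_iterate_eq hu w hδ l j hx (by linarith) ?_
  have h1 := hP.travelTime_nonneg j hx
  have h2 : (k : ℝ) * (T + 1) < k * (q * δ) := mul_lt_mul_of_pos_left hq (by linarith)
  have h3 : (k : ℝ) * (q * δ) ≤ l * δ := by
    rw [← mul_assoc]
    exact mul_le_mul_of_nonneg_right (by exact_mod_cast hle) h0.le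
  linarith

/-- To reach an arbitrary `t > T`, restart the solution at time `t - T`: the restarted solution is
fixed by its own `Q`, whose `q`-th power vanishes at time `T`. -/
theorem isFTSCont_of_QPowersVanish (h : P.QPowersVanish) : P.IsFTSCont := by
  obtain ⟨T, hT, q, -, hz⟩ := h
  refine ⟨T, hT, fun φ _ u hu x hx t ht => ?_⟩
  have hs := hP.isContSol_shift hu (r := t - T) (by linarith)
  have h1 := hz 1 one_pos _ hs.1.1 x hx
  rw [hP.Q_iterate_eq_of_isContSol hs (fun y _ => by simp) _ _ ⟨hx, by simpa using hT.le⟩] at h1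
  simpa using h1

theorem QPowersVanish_of_isFTSCont (hex : ∀ φ, P.InCh φ → ∃ u, P.IsContSol φ u)
    (h : P.IsFTSCont) : P.QPowersVanish := by
  obtain ⟨T, hT, hz⟩ := h
  obtain ⟨q, hq, hQ⟩ := hP.exists_Q_iterate_eq_zero hT
  refine ⟨T + 1, by linarith, q, hq, fun k hk w hw x hx => ?_⟩
  have hφ : P.InCh fun y => w (y, 0) :=
    ⟨hw.1.comp (by fun_prop) fun y hy => ⟨hy, le_rfl⟩, hw.2⟩
  obtain ⟨u, hu⟩ := hex _ hφ
  exact hQ _ u hu.2 (hz _ hφ u hu) k hk w x hx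

end Admissible

end Hyperbolic.Problem

/-! ### Regularity of solutions of difference equations -/

section Delay

variable {n : ℕ} {δ : ℝ} {τ : Fin n → ℝ} {ψ g : ℝ → Fin n → ℝ} {H : (Fin n → ℝ) → Fin n → ℝ}

/-- Continuity propagates through the delays; the only place where two formulas meet is `s = 0`, and
`hcomp` glues them there. -/
theorem continuous_delay_solution (hδ : 0 < δ) (hτ : ∀ i, δ ≤ τ i) (hψ : Continuous ψ)
    (hH : Continuous H) (hcomp : ψ 0 = H fun i => ψ (-τ i) i) (hneg : ∀ s < 0, g s = ψ s)
    (hpos : ∀ s, 0 ≤ s → g s = H fun i => g (s - τ i) i) : Continuous g := by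
  refine continuous_iff_continuousAt.2 fun s => delay_induction hδ (fun s hs => ?_)
    (fun s hs ih => ?_) s
  · exact hψ.continuousAt.congr ((eventually_lt_nhds hs).mono fun r hr => (hneg r hr).symm)
  · have hc : ContinuousAt (fun r => H fun i => g (r - τ i) i) s := by
      refine hH.continuousAt.comp (continuousAt_pi.2 fun i => ?_)
      exact (continuousAt_pi.1 (ih (s - τ i) (by linarith [hτ i])) i).comp
        (f := fun r => r - τ i) (by fun_prop)
    rcases hs.eq_or_lt with rfl | hs
    · have h0 : g 0 = ψ 0 := by
        rw [hpos 0 le_rfl, hcomp]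
        congr 1
        ext i
        rw [zero_sub, hneg _ (by linarith [hτ i])]
      refine continuousAt_iff_continuous_left_right.2 ⟨?_, ?_⟩
      · refine hψ.continuousWithinAt.congr (fun r hr => ?_) h0
        rcases (mem_Iic.1 hr).eq_or_lt with rfl | hr
        exacts [h0, hneg r hr]
      · exact hc.continuousWithinAt.congr (fun r hr => hpos r hr) (hpos 0 le_rfl)
    · exact hc.congr ((eventually_gt_nhds hs).mono fun r hr => (hpos r hr.le).symm)

/-- The times that are sums of delays. -/
def delaySums (τ : Fin n → ℝ) : Set ℝ := range fun k : Fin n → ℕ => ∑ i, (k i : ℝ) * τ i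

theorem countable_delaySums (τ : Fin n → ℝ) : (delaySums τ).Countable := countable_range _

theorem zero_mem_delaySums (τ : Fin n → ℝ) : (0 : ℝ) ∈ delaySums τ := ⟨0, by simp⟩

theorem add_mem_delaySums {s : ℝ} (hs : s ∈ delaySums τ) (i : Fin n) :
    s + τ i ∈ delaySums τ := by
  obtain ⟨k, rfl⟩ := hs
  refine ⟨k + Pi.single i 1, ?_⟩
  simp [add_mul, Finset.sum_add_distrib, Pi.single_apply]

theorem nonneg_of_mem_delaySums (hτ : ∀ i, 0 ≤ τ i) {s : ℝ} (hs : s ∈ delaySums τ) : 0 ≤ s := by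
  obtain ⟨k, rfl⟩ := hs
  exact Finset.sum_nonneg fun i _ => mul_nonneg (Nat.cast_nonneg _) (hτ i)

/-- The gluing at `0` is only continuous, and a kink at `d` can reappear at each `d + τ i`; kinks
are thus confined to sums of delays. -/
theorem contDiffAt_delay_solution (hδ : 0 < δ) (hτ : ∀ i, δ ≤ τ i) (hψ : ContDiff ℝ 1 ψ)
    (hH : ContDiff ℝ 1 H) (hneg : ∀ s < 0, g s = ψ s)
    (hpos : ∀ s, 0 ≤ s → g s = H fun i => g (s - τ i) i) (s : ℝ) :
    s ∉ delaySums τ → ContDiffAt ℝ 1 g s := by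
  refine delay_induction (p := fun s => s ∉ delaySums τ → ContDiffAt ℝ 1 g s) hδ
    (fun s hs _ => ?_) (fun s hs ih hD => ?_) s
  · exact hψ.contDiffAt.congr_of_eventuallyEq ((eventually_lt_nhds hs).mono hneg)
  · have hs : 0 < s := hs.lt_of_ne fun h => hD (h ▸ zero_mem_delaySums τ)
    have hc : ContDiffAt ℝ 1 (fun r => H fun i => g (r - τ i) i) s := by
      refine hH.contDiffAt.comp s (contDiffAt_pi.2 fun i => ?_)
      refine (contDiffAt_pi.1 (ih (s - τ i) (by linarith [hτ i]) fun h => hD ?_) i).comp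
        (f := fun r => r - τ i) s (by fun_prop)
      simpa using add_mem_delaySums h i
    exact hc.congr_of_eventuallyEq ((eventually_gt_nhds hs).mono fun r hr => hpos r hr.le)

end Delay

/-! ### Solutions for compatible `C¹` initial functions -/

namespace Hyperbolic

theorem uniqueDiffOn_strip : UniqueDiffOn ℝ strip := by
  have : strip = Icc (0 : ℝ) 1 ×ˢ Ici (0 : ℝ) := rfl
  rw [this]
  exact (uniqueDiffOn_Icc zero_lt_one).prod (uniqueDiffOn_Ici 0)

namespace Problem

variable {n : ℕ} (P : Problem n)

/-- The function on the strip with given values along the characteristics. -/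
def transport (g : ℝ → Fin n → ℝ) (p : ℝ × ℝ) : Fin n → ℝ := fun j =>
  P.weight j p.1 * g (p.2 - P.travelTime j p.1) j

variable {P}

theorem contDiff_reflect (hh : ContDiff ℝ 1 P.h) : ContDiff ℝ 1 P.reflect :=
  hh.comp (contDiff_pi.2 fun i => contDiff_const.mul (contDiff_apply ℝ ℝ i))

namespace Admissible

variable (hP : P.Admissible)
include hP

theorem contDiff_history {φ : ℝ → Fin n → ℝ} (hφ : ContDiff ℝ 1 φ) :
    ContDiff ℝ 1 (P.history φ) := by
  refine contDiff_pi.2 fun j => ?_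
  have hσ : ContDiff ℝ 1 fun s => P.position j (-s) := (hP.contDiff_position j).comp contDiff_neg
  exact ((contDiff_pi.1 hφ j).comp hσ).div ((hP.contDiff_weight j).comp hσ)
    fun s => (P.weight_pos j _).ne'

theorem continuous_reflect : Continuous P.reflect :=
  hP.continuous_h.comp (by fun_prop)

/-- The compatibility condition on `φ` is exactly the difference equation at `s = 0`. -/
theorem history_zero {φ : ℝ → Fin n → ℝ} (hφ : P.out φ = P.h (P.inn φ)) :
    P.history φ 0 = P.reflect fun i => P.history φ (-P.crossTime i) i := by
  have h1 : P.history φ 0 = P.out φ := by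
    ext j
    have : P.position j 0 = P.outEnd j := by
      rw [← P.travelTime_outEnd j, hP.position_travelTime]
    simp [history, this, out]
  rw [h1, hφ, reflect]
  congr 1
  ext i
  simp only [history, neg_neg, crossTime, hP.position_travelTime, inn]
  rw [mul_div_cancel₀ _ (P.weight_pos i _).ne']

theorem transport_eq_Q {φ : ℝ → Fin n → ℝ} {g : ℝ → Fin n → ℝ}
    (hneg : ∀ s < 0, g s = P.history φ s)
    (hpos : ∀ s, 0 ≤ s → g s = P.reflect fun i => g (s - P.crossTime i) i) :
    ∀ p ∈ strip, P.transport g p = P.Q φ (P.transport g) p := by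
  rintro ⟨x, t⟩ ⟨hx, ht⟩
  ext j
  rw [hP.Q_eq _ _ _ hx ht, transport]
  congr 1
  split_ifs with h
  · rw [hneg _ h]
  · rw [hpos _ (not_lt.1 h)]
    rfl

theorem contDiffAt_transport {g : ℝ → Fin n → ℝ} {p : ℝ × ℝ}
    (hg : ∀ j, ContDiffAt ℝ 1 g (p.2 - P.travelTime j p.1)) :
    ContDiffAt ℝ 1 (P.transport g) p := by
  refine contDiffAt_pi.2 fun j => ?_
  have h1 : ContDiffAt ℝ 1 (fun p : ℝ × ℝ => p.2 - P.travelTime j p.1) p :=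
    contDiffAt_snd.sub ((hP.contDiff_travelTime j).contDiffAt.comp p contDiffAt_fst)
  exact ((hP.contDiff_weight j).contDiffAt.comp p contDiffAt_fst).mul
    (ContDiffAt.comp (g := fun s => g s j) p (contDiffAt_pi.1 (hg j) j) h1)

/-- The identities `weight' = -(damping / speed) * weight` and `travelTime' = 1 / speed` make all
terms cancel. -/
theorem transport_equation {g : ℝ → Fin n → ℝ} {p : ℝ × ℝ}
    (hg : ∀ j, ContDiffAt ℝ 1 g (p.2 - P.travelTime j p.1)) (j : Fin n) :
    fderiv ℝ (P.transport g) p (0, 1) j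
      + P.speed j p.1 * fderiv ℝ (P.transport g) p (1, 0) j
      + P.damping j p.1 * P.transport g p j = 0 := by
  obtain ⟨x, t⟩ := p
  simp only at hg ⊢
  have hF : HasFDerivAt (fun q => P.transport g q j)
      ((ContinuousLinearMap.proj j).comp (fderiv ℝ (P.transport g) (x, t))) (x, t) :=
    hasFDerivAt_pi'.1 ((hP.contDiffAt_transport hg).differentiableAt one_ne_zero).hasFDerivAt j
  obtain ⟨d, hd⟩ : ∃ d, HasDerivAt (fun s => g s j) d (t - P.travelTime j x) :=
    ⟨_, ((contDiffAt_pi.1 (hg j) j).differentiableAt one_ne_zero).hasDerivAt⟩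
  have ht : HasDerivAt (fun s => P.transport g (x, s) j) (P.weight j x * d) t :=
    (HasDerivAt.comp_sub_const t _ hd).const_mul (P.weight j x)
  have hx : HasDerivAt (fun y => P.transport g (y, t) j)
      (-(P.damping j x / P.speed j x) * P.weight j x * g (t - P.travelTime j x) j
        + P.weight j x * (d * -(1 / P.speed j x))) x :=
    (hP.hasDerivAt_weight j x).mul
      (HasDerivAt.comp (h₂ := fun s => g s j) x hd ((hP.hasDerivAt_travelTime j x).const_sub t))
  have ht' := (hF.comp_hasDerivAt t ((hasDerivAt_const t x).prodMk (hasDerivAt_id t))).unique ht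
  have hx' := (HasFDerivAt.comp_hasDerivAt (f := fun y => (y, t)) x hF
    ((hasDerivAt_id x).prodMk (hasDerivAt_const x t))).unique hx
  simp only [ContinuousLinearMap.comp_apply, ContinuousLinearMap.proj_apply] at ht' hx'
  rw [ht', hx', transport]
  field_simp [hP.speed_ne j x]
  ring

/-- A `C¹` initial function that satisfies the compatibility condition has a solution which is
both a continuous and a piecewise continuously differentiable one. -/
theorem exists_solution (hh : ContDiff ℝ 1 P.h) {φ : ℝ → Fin n → ℝ} (hφ : ContDiff ℝ 1 φ)
    (hcomp : P.out φ = P.h (P.inn φ)) : ∃ u, P.IsContSol φ u ∧ P.IsPC1Sol φ u := by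
  obtain ⟨δ, h0, hδ⟩ := hP.exists_le_crossTime
  obtain ⟨g, hneg, hpos⟩ := exists_delay_solution h0 hδ (P.history φ) P.reflect
  have hψ := hP.contDiff_history hφ
  have hg : Continuous g := continuous_delay_solution h0 hδ hψ.continuous hP.continuous_reflect
    (hP.history_zero hcomp) hneg hpos
  have hgD := contDiffAt_delay_solution h0 hδ hψ (contDiff_reflect hh) hneg hpos
  have hQ := hP.transport_eq_Q hneg hpos
  have hcont : Continuous (P.transport g) := by
    refine continuous_pi fun j => ?_
    have := (hP.contDiff_weight j).continuous
    have := (hP.contDiff_travelTime j).continuous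
    have := continuous_pi_iff.1 hg j
    unfold transport
    fun_prop
  have hout : ∀ t : ℝ, 0 ≤ t →
      P.out (fun x => P.transport g (x, t)) = P.h (P.inn fun x => P.transport g (x, t)) := by
    intro t ht
    ext j
    simp only [out]
    rw [hQ _ ⟨P.outEnd_mem j, ht⟩, hP.Q_eq _ _ _ (P.outEnd_mem j) ht]
    simp [ht.not_gt, R]
  have hinit : ∀ x ∈ Icc (0 : ℝ) 1, P.transport g (x, 0) = φ x := by
    intro x hx
    ext j
    have hg0 : ∀ s ≤ 0, g s = P.history φ s := by
      intro s hs
      rcases hs.eq_or_lt with rfl | hs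
      · rw [hpos 0 le_rfl, hP.history_zero hcomp]
        congr 1
        ext i
        rw [zero_sub, hneg _ (neg_neg_of_pos (hP.crossTime_pos i))]
      · exact hneg s hs
    simp only [transport, zero_sub]
    rw [hg0 _ (neg_nonpos.2 (hP.travelTime_nonneg j hx)), history, neg_neg,
      hP.position_travelTime, mul_div_cancel₀ _ (P.weight_pos j _).ne']
  refine ⟨P.transport g, ⟨⟨⟨hcont.continuousOn, hout 0 le_rfl⟩, hinit⟩, hQ⟩, hcont.continuousOn,
    ?_, hinit, hout⟩
  -- The exceptional curves are the characteristics that enter at sums of crossing times, countably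
  -- many.
  refine ⟨(fun q : Fin n × ℝ => (q.1, (P.outEnd q.1, q.2))) '' (univ ×ˢ delaySums P.crossTime),
    (countable_univ.prod (countable_delaySums _)).image _, ?_, _, rfl, ?_⟩
  · rintro _ ⟨⟨j, d⟩, ⟨-, hd⟩, rfl⟩
    exact ⟨P.outEnd_mem j, nonneg_of_mem_delaySums (fun i => (hP.crossTime_pos i).le) hd⟩
  set N : Set (ℝ × ℝ) := ⋃ γ ∈ (fun q : Fin n × ℝ => (q.1, (P.outEnd q.1, q.2))) ''
    (univ ×ˢ delaySums P.crossTime), P.charCurve γ.1 γ.2 with hN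
  have hreg : ∀ p ∈ strip \ N, ∀ j, ContDiffAt ℝ 1 g (p.2 - P.travelTime j p.1) := by
    intro p hp j
    refine hgD _ fun hd => hp.2 ?_
    refine mem_biUnion (mem_image_of_mem _ (show (j, _) ∈ _ from ⟨mem_univ j, hd⟩)) ⟨hp.1.1, ?_⟩
    simp only
    rw [hP.ω_eq j _ (P.outEnd_mem j) hp.1.1, travelTime_outEnd]
    ring
  have hC : ∀ p ∈ strip \ N, ContDiffAt ℝ 1 (P.transport g) p := fun p hp =>
    hP.contDiffAt_transport (hreg p hp)
  have hfd : ∀ p ∈ strip \ N,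
      fderivWithin ℝ (P.transport g) strip p = fderiv ℝ (P.transport g) p := fun p hp =>
    ((hC p hp).differentiableAt one_ne_zero).fderivWithin (uniqueDiffOn_strip p hp.1)
  refine ⟨fun p hp => ((hC p hp).differentiableAt one_ne_zero).differentiableWithinAt, ?_, ?_⟩
  · exact ContinuousOn.congr (fun p hp =>
      ((hC p hp).fderiv_right (m := 0) (by simp)).continuousAt.continuousWithinAt) hfd
  · intro p hp _ _ _ j
    rw [hfd p hp, ← P.speed_of_mem j hp.1.1, ← P.damping_of_mem j hp.1.1]
    exact hP.transport_equation (hreg p hp) j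

end Admissible

end Problem

end Hyperbolic

/-! ### Approximation by `C¹` functions -/

/-- Functions of class `L^p` on `(0,1)` are approximated by smooth functions that vanish at the
end points. -/
theorem exists_contDiff_eLpNorm_sub_le {F : Type*} [NormedAddCommGroup F] [NormedSpace ℝ F]
    {p : ENNReal} (hp1 : 1 ≤ p) (hp : p ≠ ⊤) {f : ℝ → F}
    (hf : MemLp f p (volume.restrict (Ioo (0 : ℝ) 1))) {ε : ℝ} (hε : 0 < ε) :
    ∃ g : ℝ → F, ContDiff ℝ 1 g ∧ g 0 = 0 ∧ g 1 = 0 ∧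
      eLpNorm (f - g) p (volume.restrict (Ioo (0 : ℝ) 1)) ≤ ENNReal.ofReal ε := by
  set μ := volume.restrict (Ioo (0 : ℝ) 1) with hμ
  obtain ⟨κ, hκ, hsmall⟩ := hf.eLpNorm_indicator_le hp1 hp (half_pos hε)
  set r : ℝ := min (κ / 2) (1 / 4) with hr
  have hr0 : 0 < r := by positivity
  have hr1 : r ≤ 1 / 4 := min_le_right _ _
  -- The cut-off is `1` on `K = [r, 1 - r]` and vanishes outside `(r / 2, 1 - r / 2)`; the rest of
  -- `(0,1)` has measure at most `2 * r ≤ κ`.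
  let χ : ContDiffBump (1 / 2 : ℝ) := ⟨1 / 2 - r, 1 / 2 - r / 2, by linarith, by linarith⟩
  set K : Set ℝ := Metric.closedBall (1 / 2) (1 / 2 - r) with hK
  have hKm : MeasurableSet K := Metric.isClosed_closedBall.measurableSet
  have hμK : μ Kᶜ ≤ ENNReal.ofReal κ := by
    rw [hμ, Measure.restrict_apply hKm.compl]
    have hsub : Kᶜ ∩ Ioo 0 1 ⊆ Ioc 0 r ∪ Ico (1 - r) 1 := by
      rintro x ⟨hx, hx0, hx1⟩
      rw [hK, mem_compl_iff, Metric.mem_closedBall, not_le, Real.dist_eq, lt_abs] at hx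
      rcases hx with hx | hx
      · exact Or.inr ⟨by linarith, hx1⟩
      · exact Or.inl ⟨hx0, by linarith⟩
    refine (measure_mono hsub).trans ((measure_union_le _ _).trans ?_)
    rw [Real.volume_Ioc, Real.volume_Ico, ← ENNReal.ofReal_add (by linarith) (by linarith)]
    exact ENNReal.ofReal_le_ofReal (by linarith [min_le_left (κ / 2) (1 / 4 : ℝ)])
  have h1 : eLpNorm (f - K.indicator f) p μ ≤ ENNReal.ofReal (ε / 2) := by
    rw [← indicator_compl]
    exact hsmall _ hKm.compl hμK
  have hfK : MemLp (K.indicator f) p μ := hf.indicator hKm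
  obtain ⟨g, -, hg, hgle⟩ := hfK.exist_eLpNorm_sub_le hp hp1 (half_pos hε)
  have hgC : ContDiff ℝ 1 g := hg.of_le (by exact_mod_cast le_top)
  refine ⟨fun x => χ x • g x, χ.contDiff.smul hgC, ?_, ?_, ?_⟩
  · simp only
    rw [χ.zero_of_le_dist, zero_smul]
    simp only [χ, Real.dist_eq]
    rw [le_abs]
    right
    linarith
  · simp only
    rw [χ.zero_of_le_dist, zero_smul]
    simp only [χ, Real.dist_eq]
    rw [le_abs]
    left
    linarith
  -- Cutting off `g` costs nothing: on `K` the error is unchanged, and off `K` the target is zero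
  -- while `χ` shrinks `g`.
  · have h2 : eLpNorm (K.indicator f - fun x => χ x • g x) p μ ≤ ENNReal.ofReal (ε / 2) := by
      refine (eLpNorm_mono fun x => ?_).trans hgle
      by_cases hx : x ∈ K
      · simp [indicator_of_mem hx, χ.one_of_mem_closedBall hx]
      · simp only [Pi.sub_apply, indicator_of_notMem hx, zero_sub, norm_neg, norm_smul]
        rw [Real.norm_of_nonneg χ.nonneg]
        exact mul_le_of_le_one_left (norm_nonneg _) χ.le_one
    have hsplit : (f - fun x => χ x • g x)
        = (f - K.indicator f) + (K.indicator f - fun x => χ x • g x) := by abel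
    rw [hsplit, ← add_halves ε, ENNReal.ofReal_add (half_pos hε).le (half_pos hε).le]
    refine (eLpNorm_add_le (hf.aestronglyMeasurable.sub hfK.aestronglyMeasurable)
      (hfK.aestronglyMeasurable.sub ?_) hp1).trans (add_le_add h1 h2)
    exact (χ.contDiff.smul hgC (n := 1)).continuous.aestronglyMeasurable

/-- Continuous functions on `[0,1]` are approximated by `C¹` functions with the same values at
the end points. -/
theorem exists_contDiff_tendsto {F : Type*} [NormedAddCommGroup F] [NormedSpace ℝ F]
    {f : ℝ → F} (hf : ContinuousOn f (Icc 0 1)) :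
    ∃ g : ℕ → ℝ → F, (∀ l, ContDiff ℝ 1 (g l) ∧ g l 0 = f 0 ∧ g l 1 = f 1) ∧
      ∀ x ∈ Icc (0 : ℝ) 1, Tendsto (fun l => g l x) atTop (𝓝 (f x)) := by
  let f' : C(unitInterval, F) := ⟨fun x => f x, hf.domRestrict⟩
  -- Bernstein polynomials interpolate at both ends; the degree `l + 1` is positive, as the value at
  -- `1` requires.
  let g : ℕ → ℝ → F := fun l x => ∑ k : Fin (l + 2),
    (bernsteinPolynomial ℝ (l + 1) k).eval x • f' (bernstein.z k)
  have hg : ∀ l (x : unitInterval), g l x = bernsteinApproximation (l + 1) f' x := fun l x => by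
    rw [bernsteinApproximation.apply]
    rfl
  refine ⟨g, fun l => ⟨?_, ?_, ?_⟩, fun x hx => ?_⟩
  · exact ContDiff.sum fun k _ => (Polynomial.contDiff_aeval _ _).smul contDiff_const
  · exact (hg l 0).trans (bernsteinApproximation.apply_zero _ _)
  · exact (hg l 1).trans (bernsteinApproximation.apply_one l.succ_ne_zero _)
  · have h := (continuous_eval_const (F := C(unitInterval, F)) ⟨x, hx⟩).continuousAt.tendsto.comp
      ((bernsteinApproximation_uniform f').comp (tendsto_add_atTop_nat 1))
    refine h.congr fun l => ?_
    exact (hg l ⟨x, hx⟩).symm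

/-! ### Generalized solutions in `L²` -/

namespace Hyperbolic

theorem eq_zero_of_distL2_le {n : ℕ} {v : L2 n}
    (h : ∀ ε : ENNReal, 0 < ε → distL2 (fun _ => 0) v ≤ ε) : v = 0 := by
  have h0 : distL2 (fun _ => 0) v = 0 := nonpos_iff_eq_zero.1 (le_of_forall_pos_le_add fun ε hε => by
    simpa using h ε hε)
  have h1 : eLpNorm v 2 (volume.restrict (Ioo (0 : ℝ) 1)) = 0 := by
    rw [← h0, distL2, ← eLpNorm_neg]
    congr 1
    ext x
    simp
  rw [eLpNorm_eq_zero_iff (Lp.aestronglyMeasurable v) (by norm_num)] at h1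
  exact (Lp.eq_zero_iff_ae_eq_zero).2 h1

theorem eqOn_zero_of_distL2_le {n : ℕ} {f : ℝ → Fin n → ℝ} (hf : ContinuousOn f (Icc 0 1))
    (h : ∀ ε : ENNReal, 0 < ε → distL2 f (0 : L2 n) ≤ ε) :
    ∀ x ∈ Icc (0 : ℝ) 1, f x = 0 := by
  have h0 : distL2 f 0 = 0 := nonpos_iff_eq_zero.1 (le_of_forall_pos_le_add fun ε hε => by
    simpa using h ε hε)
  have hF : ContinuousOn (fun x => WithLp.toLp 2 (f x)) (Icc 0 1) :=
    (PiLp.continuous_toLp 2 _).comp_continuousOn hf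
  have hm : AEStronglyMeasurable (fun x => WithLp.toLp 2 (f x) - (0 : L2 n) x)
      (volume.restrict (Ioo (0 : ℝ) 1)) :=
    ((hF.mono Ioo_subset_Icc_self).aestronglyMeasurable measurableSet_Ioo).sub
      (Lp.aestronglyMeasurable _)
  rw [distL2, eLpNorm_eq_zero_iff hm (by norm_num)] at h0
  have hae : f =ᵐ[volume.restrict (Icc (0 : ℝ) 1)] fun _ => 0 := by
    rw [← Measure.restrict_congr_set Ioo_ae_eq_Icc]
    filter_upwards [h0, Lp.coeFn_zero (EuclideanSpace ℝ (Fin n)) 2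
      (volume.restrict (Ioo (0 : ℝ) 1))] with x hx hx0
    rw [hx0] at hx
    simpa using hx
  exact Measure.eqOn_Icc_of_ae_eq volume zero_ne_one hae hf continuousOn_const

namespace Problem

variable {n : ℕ} {P : Problem n}

/-- Compatible `C¹` functions are dense in `L²`. -/
theorem Admissible.exists_tendsto_distL2 (hP : P.Admissible) (φ : L2 n) :
    ∃ φs : ℕ → ℝ → Fin n → ℝ,
      (∀ l, ContDiff ℝ 1 (φs l) ∧ P.out (φs l) = P.h (P.inn (φs l))) ∧
      Tendsto (fun l => distL2 (φs l) φ) atTop (𝓝 0) := by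
  have h : ∀ l : ℕ, ∃ g : ℝ → Fin n → ℝ, (ContDiff ℝ 1 g ∧ P.out g = P.h (P.inn g)) ∧
      distL2 g φ ≤ ENNReal.ofReal (1 / ((l : ℝ) + 1)) := by
    intro l
    obtain ⟨g, hg, h0, h1, hle⟩ := exists_contDiff_eLpNorm_sub_le (by norm_num) (by norm_num)
      (Lp.memLp φ) (Nat.one_div_pos_of_nat (α := ℝ) (n := l))
    have hout : P.out (fun x => (g x).ofLp) = 0 := by
      ext j; unfold out outEnd; split_ifs <;> simp [h0, h1]
    have hinn : P.inn (fun x => (g x).ofLp) = 0 := by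
      ext j; unfold inn inEnd; split_ifs <;> simp [h0, h1]
    refine ⟨fun x => (g x).ofLp, ⟨?_, by rw [hout, hinn, hP.h_zero]⟩, ?_⟩
    · exact (PiLp.continuousLinearEquiv 2 ℝ _).contDiff.comp hg
    · rw [eLpNorm_sub_comm] at hle
      exact hle
  choose φs h1 h2 using h
  refine ⟨φs, h1, tendsto_of_tendsto_of_tendsto_of_le_of_le tendsto_const_nhds ?_
    (fun _ => zero_le) h2⟩
  simpa using ENNReal.tendsto_ofReal (tendsto_one_div_add_atTop_nhds_zero_nat (𝕜 := ℝ))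

namespace Admissible

variable (hP : P.Admissible)
include hP

/-- The approximating piecewise `C¹` solutions are also continuous ones, so they vanish after the
same `T`, and so does their `L²` limit. -/
theorem isFTSL2_of_QPowersVanish (hh : ContDiff ℝ 1 P.h) (h : P.QPowersVanish) : P.IsFTSL2 := by
  obtain ⟨T, hT, hz⟩ := hP.isFTSCont_of_QPowersVanish h
  refine ⟨T, hT, fun φ v hv t ht => eq_zero_of_distL2_le fun ε hε => ?_⟩
  obtain ⟨φs, hφs, hlim⟩ := hP.exists_tendsto_distL2 φ
  choose us hc hpc using fun l => hP.exists_solution hh (hφs l).1 (hφs l).2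
  have hev := hv.2 φs (fun l => ⟨(hφs l).1.contDiffOn, (hφs l).2⟩) hlim us hpc t
    (hT.trans ht) ε hε
  obtain ⟨l, hl⟩ := hev.exists
  refine le_trans (le_of_eq (eLpNorm_congr_ae ?_)) (hl t ⟨(hT.trans ht).le, le_rfl⟩)
  filter_upwards [ae_restrict_mem measurableSet_Ioo] with x hx
  rw [hz _ ⟨(hφs l).1.continuous.continuousOn, (hφs l).2⟩ _ (hc l) x (Ioo_subset_Icc_self hx) t ht]

/-- Keeping the end values of `w (·, 0)` keeps the approximations compatible, and pointwise
convergence suffices to pass to the limit in a fixed iterate of `Q`. -/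
theorem QPowersVanish_of_isFTSL2 (hh : ContDiff ℝ 1 P.h) (hex : ∀ φ, ∃ v, P.IsL2Sol φ v)
    (h : P.IsFTSL2) : P.QPowersVanish := by
  obtain ⟨T, hT, hz⟩ := h
  obtain ⟨q, hq, hQ⟩ := hP.exists_Q_iterate_eq_zero hT
  refine ⟨T + 1, by linarith, q, hq, fun k hk w hw x hx => ?_⟩
  have hcont : ContinuousOn (fun y => w (y, 0)) (Icc 0 1) :=
    hw.1.comp (by fun_prop) fun y hy => ⟨hy, le_rfl⟩
  obtain ⟨φs, hφs, hlim⟩ := exists_contDiff_tendsto hcont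
  have hcomp : ∀ l, P.out (φs l) = P.h (P.inn (φs l)) := fun l => by
    have h1 : P.out (φs l) = P.out fun y => w (y, 0) := by
      ext j; unfold out outEnd; split_ifs <;> simp [hφs l]
    have h2 : P.inn (φs l) = P.inn fun y => w (y, 0) := by
      ext j; unfold inn inEnd; split_ifs <;> simp [hφs l]
    rw [h1, h2, hw.2]
  refine tendsto_nhds_unique (hP.tendsto_Q_iterate hlim w (k * q) (x, k * (T + 1))
    ⟨hx, by positivity⟩) ((tendsto_const_nhds (x := (0 : Fin n → ℝ))).congr fun l => ?_)
  obtain ⟨u, hu, hpc⟩ := hP.exists_solution hh (hφs l).1 (hcomp l)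
  refine (hQ _ u hu.2 (fun y hy t ht => ?_) k hk w x hx).symm
  have hmem : MemLp (fun y => WithLp.toLp 2 (φs l y)) 2 (volume.restrict (Ioo (0 : ℝ) 1)) := by
    have hc : Continuous fun y => WithLp.toLp 2 (φs l y) :=
      (PiLp.continuous_toLp 2 _).comp (hφs l).1.continuous
    obtain ⟨M, hM⟩ := isCompact_Icc.exists_bound_of_continuousOn (s := Icc (0 : ℝ) 1)
      hc.continuousOn
    refine MemLp.of_bound hc.aestronglyMeasurable M ?_
    filter_upwards [ae_restrict_mem measurableSet_Ioo] with z hz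
    exact hM z (Ioo_subset_Icc_self hz)
  obtain ⟨v, hv⟩ := hex (hmem.toLp _)
  have hdist : distL2 (φs l) (hmem.toLp _) = 0 := by
    rw [distL2, eLpNorm_congr_ae (g := fun _ => 0), eLpNorm_zero']
    filter_upwards [hmem.coeFn_toLp] with z hz
    rw [hz, sub_self]
  have hv0 := hz _ v hv t ht
  refine eqOn_zero_of_distL2_le (f := fun y => u (y, t))
    (hu.1.1.1.comp (by fun_prop) fun z hz => ⟨hz, (hT.trans ht).le⟩) (fun ε hε => ?_) y hy
  -- The constant sequence is admissible in the definition of a generalized solution, which forces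
  -- `u (·, t)` to agree with `v t = 0` in `L²`; continuity then gives zero everywhere on `[0,1]`.
  obtain ⟨_, hi⟩ := (hv.2 (fun _ => φs l) (fun _ => ⟨(hφs l).1.contDiffOn, hcomp l⟩)
    (by rw [hdist]; exact tendsto_const_nhds) (fun _ => u) (fun _ => hpc) t (hT.trans ht) ε
    hε).exists
  have := hi t ⟨(hT.trans ht).le, le_rfl⟩
  rwa [hv0] at this

end Admissible

end Problem

end Hyperbolic

end

theorem mainTheorem3 {n : ℕ} (P : Hyperbolic.Problem n) (hm : P.m ≤ n)
    (ha : ∀ j, ContinuousOn (P.a j) (Set.Icc 0 1))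
    (hb : ∀ j, ContinuousOn (P.b j) (Set.Icc 0 1))
    (hh : Continuous P.h)
    (hsep : ∃ a₀ : ℝ, 0 < a₀ ∧ ∀ j : Fin n, ∀ x ∈ Set.Icc (0 : ℝ) 1,
      ((j : ℕ) < P.m → a₀ ≤ P.a j x) ∧ (P.m ≤ (j : ℕ) → P.a j x ≤ -a₀))
    (h0 : P.h 0 = 0) :
    ((∀ φ, P.InCh φ → ∃ u, P.IsContSol φ u) →
      (P.IsFTSCont ↔ P.QPowersVanish)) ∧
    ((∀ j, ContDiffOn ℝ 1 (P.a j) (Set.Icc 0 1)) →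
      (∀ j, ContDiffOn ℝ 1 (P.b j) (Set.Icc 0 1)) →
      ContDiff ℝ 1 P.h →
      (∀ φ, ∃ u, P.IsL2Sol φ u) →
      (P.IsFTSL2 ↔ P.QPowersVanish)) := by
  have hP : P.Admissible := ⟨ha, hb, hh, hsep, h0⟩
  refine ⟨fun hex => ⟨hP.QPowersVanish_of_isFTSCont hex, hP.isFTSCont_of_QPowersVanish⟩, ?_⟩
  exact fun _ _ hC hex => ⟨hP.QPowersVanish_of_isFTSL2 hC hex, hP.isFTSL2_of_QPowersVanish hC⟩
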